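/- Let $R$ be an associative ring with unit, not necessarily commutative. Modules are left $R$-modules, and a class of modules is always assumed to be closed under isomorphisms. A pair $(\mathbb{T},\mathbb{F})$ of classes of modules is a torsion pair if every module in $\mathbb{T}\cap\mathbb{F}$ is $0$, $\mathbb{T}$ is closed under quotient modules, $\mathbb{F}$ is closed under submodules, and every module $M$ permits a short exact sequence $0\to T\to M\to F\to 0$ with $T\in\mathbb{T}$ and $F\in\mathbb{F}$. It is hereditary if $\mathbb{T}$ is also closed under submodules. It is of finite type if every left ideal $\mathfrak{a}$ of $R$ with $R/\mathfrak{a}\in\mathbb{T}$ contains a finitely generated left ideal $\mathfrak{b}$ with $R/\mathfrak{b}\in\mathbb{T}$. Theorem. Let $(\mathbb{T},\mathbb{F})$ be a hereditary torsion pair of finite type. Then $\mathbb{F}$ is covering. That is, for every module $M$ there is a homomorphism $f\colon F\to M$ with $F\in\mathbb{F}$ such that (i) every homomorphism $g\colon F'\to M$ with $F'\in\mathbb{F}$ factors as $g=fh$ for some homomorphism $h\colon F'\to F$, and (ii) every endomorphism $e\colon F\to F$ with $fe=f$ is an automorphism. -/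

import Mathlib

open CategoryTheory

universe u

section

variable {R : Type u} [Ring R]

/-- A pair `(T, F)` of classes of left `R`-modules closed under isomorphisms is a torsion pair if
every module in `T ∩ F` is zero, `T` is closed under quotient modules, `F` is closed under
submodules, and every module `M` sits in a short exact sequence `0 → X → M → Y → 0` with
`X` in `T` and `Y` in `F`. -/
structure IsTorsionPair (T F : ObjectProperty (ModuleCat.{u} R)) : Prop where
  torsion_iso : T.IsClosedUnderIsomorphisms
  torsionFree_iso : F.IsClosedUnderIsomorphisms
  isZero_of_mem : ∀ M : ModuleCat.{u} R, T M → F M → Limits.IsZero M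
  torsion_quotients : T.IsClosedUnderQuotients
  torsionFree_subobjects : F.IsClosedUnderSubobjects
  exists_shortExact : ∀ M : ModuleCat.{u} R, ∃ (X Y : ModuleCat.{u} R) (i : X ⟶ M) (p : M ⟶ Y)
    (w : i ≫ p = 0), (ShortComplex.mk i p w).ShortExact ∧ T X ∧ F Y

/-- A torsion pair is hereditary if its torsion class `T` is also closed under submodules. -/
structure IsHereditaryTorsionPair (T F : ObjectProperty (ModuleCat.{u} R)) : Prop
    extends IsTorsionPair T F where
  torsion_subobjects : T.IsClosedUnderSubobjects

/-- A torsion pair with torsion class `T` is of finite type if every left ideal `a` with `R ⧸ a`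
in `T` contains a finitely generated left ideal `b` with `R ⧸ b` in `T`.
Left ideals are the submodules of `R` as a left module over itself. -/
def IsOfFiniteType (T : ObjectProperty (ModuleCat.{u} R)) : Prop :=
  ∀ a : Submodule R R, T (ModuleCat.of R (R ⧸ a)) →
    ∃ b : Submodule R R, b ≤ a ∧ b.FG ∧ T (ModuleCat.of R (R ⧸ b))

/-- `f : X ⟶ M` is an `F`-precover of `M`: `X` is in `F` and every homomorphism to `M` from a
module in `F` factors through `f`. -/
structure IsPrecover (F : ObjectProperty (ModuleCat.{u} R)) {X M : ModuleCat.{u} R}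
    (f : X ⟶ M) : Prop where
  mem : F X
  exists_lift : ∀ (X' : ModuleCat.{u} R) (g : X' ⟶ M), F X' → ∃ h : X' ⟶ X, h ≫ f = g

/-- `f : X ⟶ M` is an `F`-cover of `M`: an `F`-precover such that every endomorphism of `X`
over `M` is an automorphism. -/
structure IsCover (F : ObjectProperty (ModuleCat.{u} R)) {X M : ModuleCat.{u} R}
    (f : X ⟶ M) : Prop extends IsPrecover F f where
  isIso_of_comp_eq : ∀ e : X ⟶ X, e ≫ f = f → IsIso e

/-- The class `F` is covering if every module has an `F`-cover. -/
def IsCovering (F : ObjectProperty (ModuleCat.{u} R)) : Prop :=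
  ∀ M : ModuleCat.{u} R, ∃ (X : ModuleCat.{u} R) (f : X ⟶ M), IsCover F f

end

/-! With respect to the left ideals with torsion quotient, a submodule is closed when its quotient
is torsion-free. If `f : G → M` is reduced, every map over `M` from `G` to a torsion-free module is
injective, since its kernel is closed and lies in `ker f`.

Finite type makes directed unions of closed submodules closed, so by Zorn every map from a
torsion-free module factors through a reduced quotient (`exists_isReduced_quotient`). Domains of
reduced maps to `M` have bounded size (`IsReduced.exists_code`), so Zorn also yields a reduced `f :
P → M` for which every map over `M` from `P` to the domain of a reduced map is onto
(`exists_isReduced_forall_surjective`), hence bijective.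

This `f` is the cover. Endomorphisms of `P` over `M` are bijective. Given `g : H → M` with `H`
torsion-free, `P` maps isomorphically onto a reduced quotient of `P × H`, and the image of `H` there
gives the factorization. -/

namespace LeftIdealFilter

/-! ### Closed submodules, reduced maps and a bound on their domains -/

section closed

variable {R : Type u} [Ring R] {G H M : Type u}
  [AddCommGroup G] [Module R G] [AddCommGroup H] [Module R H] [AddCommGroup M] [Module R M]

/-- A submodule `N` of `G` is closed with respect to a set `𝒢` of left ideals if it contains every
element that some member of `𝒢` multiplies into `N`. -/
def IsClosed (𝒢 : Set (Submodule R R)) (N : Submodule R G) : Prop :=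
  ∀ a ∈ 𝒢, ∀ z : G, (∀ r ∈ a, r • z ∈ N) → z ∈ N

/-- Every submodule `N` is contained in a closed one each of whose elements is multiplied into `N`
by a member of `𝒢`. -/
def HasClosures (𝒢 : Set (Submodule R R)) : Prop :=
  ∀ (G : Type u) [AddCommGroup G] [Module R G] (N : Submodule R G),
    ∃ N' : Submodule R G, N ≤ N' ∧ IsClosed 𝒢 N' ∧ ∀ y ∈ N', ∃ a ∈ 𝒢, ∀ r ∈ a, r • y ∈ N

/-- Every member of `𝒢` contains a finitely generated member. -/
def HasFGBasis (𝒢 : Set (Submodule R R)) : Prop :=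
  ∀ a ∈ 𝒢, ∃ b ∈ 𝒢, b ≤ a ∧ b.FG

variable {𝒢 : Set (Submodule R R)}

theorem IsClosed.comap {N : Submodule R H} (hN : IsClosed 𝒢 N) (φ : G →ₗ[R] H) :
    IsClosed 𝒢 (N.comap φ) := fun a ha z hz =>
  hN a ha (φ z) fun r hr => by simpa using hz r hr

theorem isClosed_comap_iff {N : Submodule R H} {φ : G →ₗ[R] H} (hφ : Function.Surjective φ) :
    IsClosed 𝒢 (N.comap φ) ↔ IsClosed 𝒢 N := by
  refine ⟨fun h a ha z hz => ?_, fun h => h.comap φ⟩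
  obtain ⟨y, rfl⟩ := hφ z
  exact h a ha y fun r hr => by simpa using hz r hr

/-- A finitely generated `b` that multiplies `z` into the directed union already multiplies it into
one member. -/
theorem IsClosed.sSup (h𝒢 : HasFGBasis 𝒢) {c : Set (Submodule R G)} (hne : c.Nonempty)
    (hdir : DirectedOn (· ≤ ·) c) (hc : ∀ N ∈ c, IsClosed 𝒢 N) : IsClosed 𝒢 (sSup c) := by
  intro a ha z hz
  obtain ⟨b, hb, hba, hfg⟩ := h𝒢 a ha
  have hmap : (b.map (LinearMap.toSpanSingleton R G z)).FG := hfg.map _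
  rw [Submodule.fg_iff_compact, CompleteLattice.isCompactElement_iff_le_of_directed_sSup_le] at hmap
  obtain ⟨N, hN, hle⟩ := hmap c hne hdir (by
    rintro _ ⟨r, hr, rfl⟩
    simpa using hz r (hba hr))
  exact le_sSup hN (hc N hN b hb z fun r hr => hle ⟨r, hr, by simp⟩)

/-- The closed submodules contained in the kernel of `f`. -/
def ClosedLEKer (𝒢 : Set (Submodule R R)) (f : G →ₗ[R] M) (N : Submodule R G) : Prop :=
  IsClosed 𝒢 N ∧ N ≤ LinearMap.ker f

/-- A homomorphism is reduced if `⊥` is closed in its domain and its kernel contains no other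
closed submodule. -/
def IsReduced (𝒢 : Set (Submodule R R)) (f : G →ₗ[R] M) : Prop :=
  Maximal (ClosedLEKer 𝒢 f) ⊥

theorem IsReduced.eq_bot {f : G →ₗ[R] M} (hf : IsReduced 𝒢 f) {N : Submodule R G}
    (hN : IsClosed 𝒢 N) (hle : N ≤ LinearMap.ker f) : N = ⊥ :=
  le_bot_iff.1 (hf.2 ⟨hN, hle⟩ bot_le)

theorem isReduced_iff_maximal_ker {f : H →ₗ[R] M} {φ : G →ₗ[R] H} (hφ : Function.Surjective φ) :
    IsReduced 𝒢 f ↔ Maximal (ClosedLEKer 𝒢 (f ∘ₗ φ)) (LinearMap.ker φ) := by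
  constructor
  · refine fun h => ⟨⟨h.1.1.comap φ, LinearMap.ker_le_ker_comp φ f⟩, fun N hN hle => ?_⟩
    have hN' : (N.map φ).comap φ = N := by rw [Submodule.comap_map_eq, sup_eq_left.2 hle]
    have : N.map φ = ⊥ := h.eq_bot ((isClosed_comap_iff hφ).1 (hN'.symm ▸ hN.1)) (by
      rintro _ ⟨x, hx, rfl⟩
      exact hN.2 hx)
    rw [← hN', this]
    exact le_rfl
  · refine fun h => ⟨⟨(isClosed_comap_iff hφ).1 h.1.1, bot_le⟩, fun N hN _ => ?_⟩
    have := h.2 ⟨hN.1.comap φ, fun x hx => hN.2 hx⟩ (fun x hx => by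
      rw [Submodule.mem_comap, LinearMap.mem_ker.1 hx]; exact N.zero_mem)
    intro y hy
    obtain ⟨x, rfl⟩ := hφ y
    exact this hy

theorem exists_isReduced_of_maximal {f : G →ₗ[R] M} {N : Submodule R G}
    (hN : Maximal (ClosedLEKer 𝒢 f) N) :
    ∃ g : (G ⧸ N) →ₗ[R] M, IsReduced 𝒢 g ∧ g ∘ₗ N.mkQ = f := by
  refine ⟨N.liftQ f hN.1.2, ?_, N.liftQ_mkQ f _⟩
  rwa [isReduced_iff_maximal_ker N.mkQ_surjective, N.liftQ_mkQ, N.ker_mkQ]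

theorem exists_isReduced_quotient (h𝒢 : HasFGBasis 𝒢) (hG : IsClosed 𝒢 (⊥ : Submodule R G))
    (f : G →ₗ[R] M) : ∃ (N : Submodule R G) (g : (G ⧸ N) →ₗ[R] M),
      IsReduced 𝒢 g ∧ g ∘ₗ N.mkQ = f := by
  obtain ⟨N, -, hN⟩ := zorn_le_nonempty₀ {N | ClosedLEKer 𝒢 f N} (fun c hc hchain N hN =>
    ⟨sSup c, ⟨IsClosed.sSup h𝒢 ⟨N, hN⟩ hchain.directedOn fun N hN => (hc hN).1,
      sSup_le fun N hN => (hc hN).2⟩, fun N hN => le_sSup hN⟩) ⊥ ⟨hG, bot_le⟩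
  exact ⟨N, exists_isReduced_of_maximal hN⟩

theorem IsReduced.injective_of_comp_eq {f : G →ₗ[R] M} (hf : IsReduced 𝒢 f) {g : H →ₗ[R] M}
    (hH : IsClosed 𝒢 (⊥ : Submodule R H)) {h : G →ₗ[R] H} (hgh : g ∘ₗ h = f) :
    Function.Injective h :=
  LinearMap.ker_eq_bot.1 <| hf.eq_bot (hH.comap h) (hgh ▸ LinearMap.ker_le_ker_comp h g)

/-- A set into which the domain of every reduced homomorphism to `M` embeds. -/
abbrev CodeSet (R M : Type u) [Ring R] [AddCommGroup M] : Type u :=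
  Set (R × R) × CharacterModule M → AddCircle (1 : ℚ)

/-- The pairs `(x, y)` with `r • y = s • x` for all `(r, s)` in `D`. -/
def solutions (G : Type u) [AddCommGroup G] [Module R G] (D : Set (R × R)) :
    AddSubgroup (G × G) where
  carrier := {p | ∀ d ∈ D, d.1 • p.2 = d.2 • p.1}
  zero_mem' := by simp
  add_mem' := fun hp hq d hd => by simp [smul_add, hp d hd, hq d hd]
  neg_mem' := fun hp d hd => by simp [hp d hd]

/-- When `0` is paired only with `0`, the solutions form the graph of a partial additive map, and
its composite with `χ ∘ f` extends to `G` because `ℚ/ℤ` is injective. The condition stands inside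
the existential so that `φ` can be chosen for all `D` and `χ`. -/
theorem exists_character_extension (f : G →ₗ[R] M) (D : Set (R × R)) (χ : CharacterModule M) :
    ∃ φ : CharacterModule G, (∀ p ∈ solutions G D, p.1 = 0 → p.2 = 0) →
      ∀ p ∈ solutions G D, φ p.1 = χ (f p.2) := by
  by_cases hD : ∀ p ∈ solutions G D, p.1 = 0 → p.2 = 0
  · let fst : solutions G D →ₗ[ℤ] G :=
      ((AddMonoidHom.fst G G).comp (solutions G D).subtype).toIntLinearMap
    have hfst : Function.Injective fst := by
      rw [injective_iff_map_eq_zero]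
      rintro ⟨p, hp⟩ h0
      exact Subtype.ext (Prod.ext h0 (hD p hp h0))
    obtain ⟨φ, hφ⟩ := CharacterModule.dual_surjective_of_injective fst hfst
      ((χ : M →+ _).comp (f.toAddMonoidHom.comp
        ((AddMonoidHom.snd G G).comp (solutions G D).subtype)))
    exact ⟨φ, fun _ p hp => DFunLike.congr_fun hφ ⟨p, hp⟩⟩
  · exact ⟨0, fun h => absurd h hD⟩

/-- If the chosen characters do not separate `x` from `x'`, they vanish at `d = x - x'`. This forces
`f` to vanish on the closure of `R d`, which is then zero. -/
theorem IsReduced.exists_code (hcl : HasClosures 𝒢) {f : G →ₗ[R] M} (hf : IsReduced 𝒢 f) :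
    ∃ Φ : G → CodeSet R M, Function.Injective Φ := by
  choose φ hφ using exists_character_extension f
  refine ⟨fun x i => φ i.1 i.2 x, fun x x' hxx' => sub_eq_zero.1 ?_⟩
  have h0 : ∀ D χ, φ D χ (x - x') = 0 := fun D χ => by
    rw [map_sub, sub_eq_zero]
    exact congr_fun hxx' (D, χ)
  generalize x - x' = d at h0
  have key : ∀ (y : G) (D : Set (R × R)), (∀ p ∈ solutions G D, p.1 = 0 → p.2 = 0) →
      (d, y) ∈ solutions G D → f y = 0 := fun y D hD hy =>
    CharacterModule.eq_zero_of_character_apply fun χ =>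
      (hφ D χ hD _ hy).symm.trans (h0 D χ)
  obtain ⟨N, hle, hN, htors⟩ := hcl G (Submodule.span R {d})
  have : N = ⊥ := hf.eq_bot hN fun y hy => by
    obtain ⟨a, ha, hay⟩ := htors y hy
    -- The equations `r • y = s • d` determine `y`: since `a • y ⊆ R d`, a solution paired with `0`
    -- is killed by `a`, hence zero.
    refine key y {p | p.1 • y = p.2 • d} (fun p hp hp1 => ?_) fun p hp => hp
    refine hf.1.1 a ha p.2 fun r hr => ?_
    obtain ⟨s, hs⟩ := Submodule.mem_span_singleton.1 (hay r hr)
    have := hp (r, s) hs.symm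
    simpa [hp1] using this
  rw [this] at hle
  exact hle (Submodule.mem_span_singleton_self d)

end closed

/-! ### Presentations of reduced maps, ordered by extension -/

section presentation

variable {R : Type u} [Ring R] {G H M : Type u}
  [AddCommGroup G] [Module R G] [AddCommGroup H] [Module R H] [AddCommGroup M] [Module R M]
  {𝒢 : Set (Submodule R R)} {X : Type u} {v : X → M}

/-- The homomorphism from the free module on the generators in `A` to `M` given by `v`. -/
noncomputable def generatorMap (R : Type u) [Ring R] [Module R M] (v : X → M) (A : Set X) :
    Finsupp.supported R R A →ₗ[R] M :=
  Finsupp.linearCombination R v ∘ₗ (Finsupp.supported R R A).subtype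

@[simp]
theorem generatorMap_apply (v : X → M) (A : Set X) (z : Finsupp.supported R R A) :
    generatorMap R v A z = Finsupp.linearCombination R v z := rfl

/-- A module with a reduced homomorphism to `M`, presented by a set of generators taken from `X`
that are pairwise distinct in the module; a generator `x` is mapped to `v x`. -/
structure ReducedPresentation (𝒢 : Set (Submodule R R)) (v : X → M) where
  gens : Set X
  rel : Submodule R (X →₀ R)
  rel_le : rel ≤ Finsupp.supported R R gens
  eq_of_single_sub_mem : ∀ x ∈ gens, ∀ y ∈ gens,
    Finsupp.single x 1 - Finsupp.single y 1 ∈ rel → x = y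
  maximal : Maximal (ClosedLEKer (G := Finsupp.supported R R gens) 𝒢 (generatorMap R v gens))
    (rel.submoduleOf (Finsupp.supported R R gens))

namespace ReducedPresentation

/-- `q` extends `p` if it has more generators, and no new relations between those of `p`. -/
def IsExtension (p q : ReducedPresentation 𝒢 v) : Prop :=
  p.gens ⊆ q.gens ∧ Finsupp.supported R R p.gens ⊓ q.rel = p.rel

theorem IsExtension.trans {p q s : ReducedPresentation 𝒢 v} (hpq : p.IsExtension q)
    (hqs : q.IsExtension s) : p.IsExtension s :=
  ⟨hpq.1.trans hqs.1, by
    rw [← hpq.2, ← hqs.2, ← inf_assoc, inf_eq_left.2 (Finsupp.supported_mono hpq.1)]⟩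

theorem IsExtension.rel_le_rel {p q : ReducedPresentation 𝒢 v} (h : p.IsExtension q) :
    p.rel ≤ q.rel := h.2 ▸ inf_le_right

theorem IsExtension.refl (p : ReducedPresentation 𝒢 v) : p.IsExtension p :=
  ⟨subset_rfl, inf_eq_right.2 p.rel_le⟩

/-- The presentation of the zero module without generators. -/
noncomputable def empty (𝒢 : Set (Submodule R R)) (v : X → M) : ReducedPresentation 𝒢 v where
  gens := ∅
  rel := ⊥
  rel_le := bot_le
  eq_of_single_sub_mem x hx := hx.elim
  maximal := by
    have h0 : ∀ z : Finsupp.supported R R (∅ : Set X), z = 0 := fun ⟨z, hz⟩ =>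
      Subtype.ext (by rwa [Finsupp.supported_empty, Submodule.mem_bot] at hz)
    refine ⟨⟨fun a ha z hz => ?_, fun z _ => ?_⟩, fun N hN hle z _ => ?_⟩
    all_goals rw [h0 z]; exact Submodule.zero_mem _

section chain

variable {c : Set (ReducedPresentation 𝒢 v)}

theorem mem_supported_iUnion_gens (hne : c.Nonempty) (hc : DirectedOn IsExtension c)
    {z : X →₀ R} : z ∈ Finsupp.supported R R (⋃ p : c, p.1.gens) ↔
      ∃ p ∈ c, z ∈ Finsupp.supported R R p.gens := by
  have := hne.to_subtype
  rw [Finsupp.supported_iUnion, Submodule.mem_iSup_of_directed]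
  · simp
  · intro p q
    obtain ⟨s, hs, hps, hqs⟩ := hc p p.2 q q.2
    exact ⟨⟨s, hs⟩, Finsupp.supported_mono hps.1, Finsupp.supported_mono hqs.1⟩

theorem mem_iSup_rel (hne : c.Nonempty) (hc : DirectedOn IsExtension c)
    {z : X →₀ R} : z ∈ (⨆ p : c, p.1.rel) ↔ ∃ p ∈ c, z ∈ p.rel := by
  have := hne.to_subtype
  rw [Submodule.mem_iSup_of_directed]
  · simp
  · intro p q
    obtain ⟨s, hs, hps, hqs⟩ := hc p p.2 q q.2
    exact ⟨⟨s, hs⟩, hps.rel_le_rel, hqs.rel_le_rel⟩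

theorem mem_rel_of_mem_iSup (hne : c.Nonempty) (hc : DirectedOn IsExtension c)
    {p : ReducedPresentation 𝒢 v} (hp : p ∈ c) {z : X →₀ R}
    (hz : z ∈ Finsupp.supported R R p.gens) (hz' : z ∈ (⨆ p : c, p.1.rel)) : z ∈ p.rel := by
  obtain ⟨q, hq, hzq⟩ := (mem_iSup_rel hne hc).1 hz'
  obtain ⟨s, hs, hps, hqs⟩ := hc p hp q hq
  exact hps.2 ▸ ⟨hz, hqs.rel_le_rel hzq⟩

/-- The union of a directed set of presentations. -/
noncomputable def directedUnion (hne : c.Nonempty) (hc : DirectedOn IsExtension c) :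
    ReducedPresentation 𝒢 v where
  gens := ⋃ p : c, p.1.gens
  rel := ⨆ p : c, p.1.rel
  rel_le := iSup_le fun p => p.1.rel_le.trans
    (Finsupp.supported_mono (Set.subset_iUnion (fun p : c => p.1.gens) p))
  eq_of_single_sub_mem x hx y hy hxy := by
    obtain ⟨p, hxp⟩ := Set.mem_iUnion.1 hx
    obtain ⟨q, hyq⟩ := Set.mem_iUnion.1 hy
    obtain ⟨s, hs, hps, hqs⟩ := hc p p.2 q q.2
    exact s.eq_of_single_sub_mem x (hps.1 hxp) y (hqs.1 hyq) <| mem_rel_of_mem_iSup hne hc hs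
      (sub_mem (Finsupp.single_mem_supported _ _ (hps.1 hxp))
        (Finsupp.single_mem_supported _ _ (hqs.1 hyq))) hxy
  maximal := by
    refine ⟨⟨fun a ha z hz => ?_, fun z hz => ?_⟩, fun N hN hle z hz => ?_⟩
    · obtain ⟨p, hp, hzp⟩ := (mem_supported_iUnion_gens hne hc).1 z.2
      -- Extensions add no relations among old generators, so closedness can be tested at the stage
      -- containing `z`.
      exact (mem_iSup_rel hne hc).2 ⟨p, hp, p.maximal.1.1 a ha ⟨z, hzp⟩ fun r hr =>
        mem_rel_of_mem_iSup hne hc hp (Submodule.smul_mem _ r hzp) (hz r hr)⟩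
    · obtain ⟨p, hp, hzp⟩ := (mem_iSup_rel hne hc).1 hz
      exact @p.maximal.1.2 ⟨z, p.rel_le hzp⟩ hzp
    · obtain ⟨p, hp, hzp⟩ := (mem_supported_iUnion_gens hne hc).1 z.2
      let i : Finsupp.supported R R p.gens →ₗ[R] Finsupp.supported R R (⋃ p : c, p.1.gens) :=
        Submodule.inclusion (Finsupp.supported_mono
          (Set.subset_iUnion (fun p : c => p.1.gens) ⟨p, hp⟩))
      have hNi : IsClosed (G := Finsupp.supported R R p.gens) 𝒢 (N.comap i) :=
        IsClosed.comap (G := Finsupp.supported R R p.gens) hN.1 i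
      have hzi : (⟨z, hzp⟩ : Finsupp.supported R R p.gens) ∈ N.comap i := hz
      exact (mem_iSup_rel hne hc).2 ⟨p, hp, p.maximal.2 ⟨hNi, fun y hy => hN.2 hy⟩
        (fun y hy => hle ((mem_iSup_rel hne hc).2 ⟨p, hp, hy⟩)) hzi⟩

theorem isExtension_directedUnion (hne : c.Nonempty) (hc : DirectedOn IsExtension c)
    {p : ReducedPresentation 𝒢 v} (hp : p ∈ c) : p.IsExtension (directedUnion hne hc) :=
  ⟨Set.subset_iUnion (fun p : c => p.1.gens) ⟨p, hp⟩, le_antisymm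
    (fun _ hz => mem_rel_of_mem_iSup hne hc hp hz.1 hz.2)
    (le_inf p.rel_le fun _ hz => (mem_iSup_rel hne hc).2 ⟨p, hp, hz⟩)⟩

end chain

theorem exists_maximal (𝒢 : Set (Submodule R R)) (v : X → M) :
    ∃ p : ReducedPresentation 𝒢 v, ∀ q, p.IsExtension q → q.IsExtension p := by
  refine exists_maximal_of_chains_bounded (fun c hc => ?_) IsExtension.trans
  rcases c.eq_empty_or_nonempty with rfl | hne
  · exact ⟨empty 𝒢 v, by simp⟩
  · have : Std.Refl (IsExtension : ReducedPresentation 𝒢 v → _ → Prop) := ⟨IsExtension.refl⟩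
    exact ⟨directedUnion hne hc.directedOn, fun p hp => isExtension_directedUnion hne _ hp⟩

end ReducedPresentation

end presentation

/-! ### From a maximal presentation to the cover -/

section cover

variable {R : Type u} [Ring R] {H M : Type u}
  [AddCommGroup H] [Module R H] [AddCommGroup M] [Module R M]
  {𝒢 : Set (Submodule R R)}

theorem linearCombination_eq_of_eqOn {X : Type u} {A : Set X} {v : X → H}
    {φ : (X →₀ R) →ₗ[R] H} (h : ∀ x ∈ A, v x = φ (Finsupp.single x 1)) {z : X →₀ R}
    (hz : z ∈ Finsupp.supported R R A) : Finsupp.linearCombination R v z = φ z := by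
  rw [Finsupp.supported_eq_span_single] at hz
  refine LinearMap.eqOn_span (s := (fun i => Finsupp.single i (1 : R)) '' A) ?_ hz
  rintro _ ⟨x, hx, rfl⟩
  simpa using h x hx

namespace ReducedPresentation

theorem exists_generator_values {X : Type u} (A : Set X)
    (h : Finsupp.supported R R A →ₗ[R] H) :
    ∃ w : X → H, ∀ z (hz : z ∈ Finsupp.supported R R A),
      Finsupp.linearCombination R w z = h ⟨z, hz⟩ := by
  classical
  refine ⟨fun x => h (Finsupp.restrictDom R R A (Finsupp.single x 1)), fun z hz => ?_⟩
  refine (linearCombination_eq_of_eqOn (φ := h ∘ₗ Finsupp.restrictDom R R A)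
    (fun x _ => rfl) hz).trans ?_
  have := LinearMap.congr_fun (Finsupp.restrictDom_comp_subtype (M := R) (R := R) A) ⟨z, hz⟩
  exact congrArg h this

/-- The generators used to present large modules over `M`: the third component ensures that there
are always enough unused generators. -/
abbrev Generator (R M : Type u) [Ring R] [AddCommGroup M] : Type u :=
  M × CodeSet R M × Set (CodeSet R M)

/-- The map induced by `h` embeds the presented module in `H`, so `H` can be presented by adding a
generator for each element not yet named. By maximality all these generators are old. -/
theorem surjective_of_maximal {p : ReducedPresentation 𝒢 (Prod.fst : Generator R M → M)}
    (hp : ∀ q, p.IsExtension q → q.IsExtension p) (hcl : HasClosures 𝒢)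
    {g : H →ₗ[R] M} (hg : IsReduced 𝒢 g) {h : Finsupp.supported R R p.gens →ₗ[R] H}
    (hgh : g ∘ₗ h = generatorMap R Prod.fst p.gens)
    (hker : p.rel.submoduleOf (Finsupp.supported R R p.gens) ≤ LinearMap.ker h) :
    Function.Surjective h := by
  classical
  obtain ⟨Φ, hΦ⟩ := hg.exists_code hcl
  obtain ⟨w, hw⟩ := exists_generator_values p.gens h
  have hkerc : IsClosed (G := Finsupp.supported R R p.gens) 𝒢 (LinearMap.ker h) :=
    fun a ha z hz => hg.1.1 a ha (h z) fun r hr => by simpa using hz r hr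
  have hrel : ∀ z ∈ Finsupp.supported R R p.gens,
      Finsupp.linearCombination R w z = 0 → z ∈ p.rel := fun z hz h0 =>
    p.maximal.2 ⟨hkerc, hgh ▸ LinearMap.ker_le_ker_comp h g⟩ hker
      (show (⟨z, hz⟩ : Finsupp.supported R R p.gens) ∈ LinearMap.ker h from
        (hw z hz).symm.trans h0)
  have hrel' : ∀ z ∈ p.rel, Finsupp.linearCombination R w z = 0 := fun z hz =>
    (hw z (p.rel_le hz)).trans (@hker ⟨z, p.rel_le hz⟩ hz)
  have hsingle : ∀ {x}, x ∈ p.gens → Finsupp.single x 1 ∈ Finsupp.supported R R p.gens :=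
    fun hx => Finsupp.single_mem_supported _ _ hx
  have hwinj : ∀ x ∈ p.gens, ∀ y ∈ p.gens, w x = w y → x = y := fun x hx y hy hxy =>
    p.eq_of_single_sub_mem x hx y hy
      (hrel _ (sub_mem (hsingle hx) (hsingle hy)) (by simp [hxy]))
  have hgw : ∀ x ∈ p.gens, g (w x) = x.1 := fun x hx => by
    have h1 := hw _ (hsingle hx)
    have h2 := LinearMap.congr_fun hgh ⟨_, hsingle hx⟩
    simp only [LinearMap.comp_apply, ← h1] at h2
    simpa using h2
  -- The old generators embed in `CodeSet R M` through `Φ ∘ w`, so by Cantor their third components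
  -- miss some `t`.
  obtain ⟨t, ht⟩ : ∃ t, ∀ x ∈ p.gens, x.2.2 ≠ t := by
    by_contra! hcon
    choose e he het using hcon
    refine Function.cantor_injective (fun t => Φ (w (e t))) fun t t' htt' => ?_
    rw [← het t, ← het t', hwinj _ (he t) _ (he t') (hΦ htt')]
  let new : H → Generator R M := fun y => (g y, Φ y, t)
  let A : Set (Generator R M) := p.gens ∪ new '' (w '' p.gens)ᶜ
  -- A new generator recovers its element from the code; values outside `A` are irrelevant.
  let w' : Generator R M → H := fun x => if x ∈ p.gens then w x else Function.invFun Φ x.2.1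
  have hw'old : ∀ x ∈ p.gens, w' x = w x := fun x hx => if_pos hx
  have hw'new : ∀ y, w' (new y) = y := fun y =>
    (if_neg fun hy => ht _ hy rfl).trans (Function.leftInverse_invFun hΦ y)
  have hgw' : ∀ x ∈ A, x.1 = g (w' x) := by
    rintro x (hx | ⟨y, -, rfl⟩)
    · rw [hw'old x hx, hgw x hx]
    · rw [hw'new]
  have hw'inj : ∀ x ∈ A, ∀ y ∈ A, w' x = w' y → x = y := by
    rintro x (hx | ⟨a, ha, rfl⟩) y (hy | ⟨b, hb, rfl⟩) hxy
    · rw [hw'old x hx, hw'old y hy] at hxy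
      exact hwinj x hx y hy hxy
    · rw [hw'old x hx, hw'new] at hxy
      exact absurd ⟨x, hx, hxy⟩ hb
    · rw [hw'old y hy, hw'new] at hxy
      exact absurd ⟨y, hy, hxy.symm⟩ ha
    · rw [hw'new, hw'new] at hxy
      rw [hxy]
  have hsurj : ∀ y, ∃ x ∈ A, w' x = y := fun y => by
    by_cases hy : y ∈ w '' p.gens
    · obtain ⟨x, hx, rfl⟩ := hy
      exact ⟨x, .inl hx, hw'old x hx⟩
    · exact ⟨new y, .inr ⟨y, hy, rfl⟩, hw'new y⟩
  let ψ : Finsupp.supported R R A →ₗ[R] H := generatorMap R w' A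
  have hψ : Function.Surjective ψ := fun y => by
    obtain ⟨x, hx, rfl⟩ := hsurj y
    exact ⟨⟨Finsupp.single x 1, Finsupp.single_mem_supported _ _ hx⟩, by simp [ψ]⟩
  have hgψ : g ∘ₗ ψ = generatorMap R Prod.fst A := LinearMap.ext fun z =>
    (linearCombination_eq_of_eqOn (φ := g ∘ₗ Finsupp.linearCombination R w')
      (fun x hx => by simpa using hgw' x hx) z.2).symm
  let q : ReducedPresentation 𝒢 (Prod.fst : Generator R M → M) :=
    { gens := A
      rel := LinearMap.ker (Finsupp.linearCombination R w') ⊓ Finsupp.supported R R A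
      rel_le := inf_le_right
      eq_of_single_sub_mem := fun x hx y hy hxy => hw'inj x hx y hy (by
        simpa [sub_eq_zero] using hxy.1)
      maximal := by
        have hk : (LinearMap.ker (Finsupp.linearCombination R w') ⊓
            Finsupp.supported R R A).submoduleOf (Finsupp.supported R R A) = LinearMap.ker ψ := by
          ext z
          exact ⟨fun hz => hz.1, fun hz => ⟨hz, z.2⟩⟩
        rw [hk, ← hgψ]
        exact (isReduced_iff_maximal_ker (G := Finsupp.supported R R A) hψ).1 hg }
  have hww' : ∀ z ∈ Finsupp.supported R R p.gens,
      Finsupp.linearCombination R w' z = Finsupp.linearCombination R w z := fun z hz =>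
    linearCombination_eq_of_eqOn (fun x hx => by simpa using hw'old x hx) hz
  have hpq : p.IsExtension q := by
    refine ⟨Set.subset_union_left, le_antisymm ?_ fun z hz => ⟨p.rel_le hz, ?_, ?_⟩⟩
    · rintro z ⟨hz, hz', -⟩
      exact hrel z hz ((hww' z hz).symm.trans hz')
    · exact (hww' z (p.rel_le hz)).trans (hrel' z hz)
    · exact Finsupp.supported_mono Set.subset_union_left (p.rel_le hz)
  intro y
  obtain ⟨x, hx, rfl⟩ := hsurj y
  have hxp : x ∈ p.gens := (hp q hpq).1 hx
  refine ⟨⟨_, hsingle hxp⟩, ?_⟩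
  rw [← hw _ (hsingle hxp), ← hww' _ (hsingle hxp)]
  simp

end ReducedPresentation

theorem isClosed_bot_prod {G : Type u} [AddCommGroup G] [Module R G]
    (hG : IsClosed 𝒢 (⊥ : Submodule R G)) (hH : IsClosed 𝒢 (⊥ : Submodule R H)) :
    IsClosed 𝒢 (⊥ : Submodule R (G × H)) := fun a ha z hz =>
  Prod.ext (hG a ha z.1 fun r hr => congrArg Prod.fst (hz r hr))
    (hH a ha z.2 fun r hr => congrArg Prod.snd (hz r hr))

theorem exists_isReduced_forall_surjective (hcl : HasClosures 𝒢) (M : Type u) [AddCommGroup M]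
    [Module R M] :
    ∃ (P : Type u) (_ : AddCommGroup P) (_ : Module R P) (f : P →ₗ[R] M), IsReduced 𝒢 f ∧
      ∀ (H : Type u) [AddCommGroup H] [Module R H] (g : H →ₗ[R] M) (h : P →ₗ[R] H),
        IsReduced 𝒢 g → g ∘ₗ h = f → Function.Surjective h := by
  obtain ⟨p, hp⟩ := ReducedPresentation.exists_maximal 𝒢 (Prod.fst :
    ReducedPresentation.Generator R M → M)
  obtain ⟨f, hf, hfK⟩ := exists_isReduced_of_maximal (G := Finsupp.supported R R p.gens) p.maximal
  refine ⟨_, inferInstance, inferInstance, f, hf, fun H _ _ g h hg hgh => ?_⟩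
  refine Function.Surjective.of_comp (ReducedPresentation.surjective_of_maximal hp hcl hg
    (h := h ∘ₗ Submodule.mkQ _) (by rw [← LinearMap.comp_assoc, hgh, hfK]) fun z hz => ?_)
  have hz0 : Submodule.mkQ (p.rel.submoduleOf (Finsupp.supported R R p.gens)) z = 0 :=
    (Submodule.Quotient.mk_eq_zero _).2 hz
  rw [LinearMap.mem_ker, LinearMap.comp_apply, hz0, map_zero]

theorem exists_cover (hfg : HasFGBasis 𝒢) (hcl : HasClosures 𝒢) (M : Type u) [AddCommGroup M]
    [Module R M] :
    ∃ (P : Type u) (_ : AddCommGroup P) (_ : Module R P) (f : P →ₗ[R] M),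
      IsClosed 𝒢 (⊥ : Submodule R P) ∧
      (∀ (H : Type u) [AddCommGroup H] [Module R H] (g : H →ₗ[R] M),
        IsClosed 𝒢 (⊥ : Submodule R H) → ∃ h : H →ₗ[R] P, f ∘ₗ h = g) ∧
      ∀ e : P →ₗ[R] P, f ∘ₗ e = f → Function.Bijective e := by
  obtain ⟨P, _, _, f, hf, hsurj⟩ := exists_isReduced_forall_surjective hcl M
  refine ⟨P, _, _, f, hf.1.1, fun H _ _ g hH => ?_, fun e he =>
    ⟨hf.injective_of_comp_eq hf.1.1 he, hsurj P f e hf he⟩⟩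
  -- Reducing `P × H` over `M` leaves a module isomorphic to `P`, by the choice of `P`.
  obtain ⟨N, k, hk, hkN⟩ :=
    exists_isReduced_quotient hfg (isClosed_bot_prod hf.1.1 hH) (f.coprod g)
  have hi : k ∘ₗ (N.mkQ ∘ₗ LinearMap.inl R P H) = f := by
    rw [← LinearMap.comp_assoc, hkN, LinearMap.coprod_inl]
  let i := LinearEquiv.ofBijective (N.mkQ ∘ₗ LinearMap.inl R P H)
    ⟨hf.injective_of_comp_eq hk.1.1 hi, hsurj _ k _ hk hi⟩
  refine ⟨i.symm.toLinearMap ∘ₗ N.mkQ ∘ₗ LinearMap.inr R P H, LinearMap.ext fun y => ?_⟩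
  have h1 : ∀ x, f (i.symm x) = k x := fun x => by
    conv_rhs => rw [← i.apply_symm_apply x]
    exact (LinearMap.congr_fun hi (i.symm x)).symm
  have h2 := LinearMap.congr_fun hkN (LinearMap.inr R P H y)
  simp only [LinearMap.comp_apply, LinearMap.coprod_apply, LinearMap.inr_apply, map_zero,
    zero_add] at h2
  simpa [h1] using h2

end cover

end LeftIdealFilter

/-! ### Translation to hereditary torsion pairs -/

section torsionPair

variable {R : Type u} [Ring R] {T F : ObjectProperty (ModuleCat.{u} R)}

open LeftIdealFilter

/-- The left ideals with torsion quotient. -/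
def torsionIdeals (T : ObjectProperty (ModuleCat.{u} R)) : Set (Submodule R R) :=
  {a | T (ModuleCat.of R (R ⧸ a))}

namespace IsHereditaryTorsionPair

theorem annihilator_mem (hTF : IsHereditaryTorsionPair T F) {X : ModuleCat.{u} R} (hX : T X)
    (x : X) : LinearMap.ker (LinearMap.toSpanSingleton R X x) ∈ torsionIdeals T := by
  have := hTF.torsion_subobjects
  let φ := (LinearMap.ker (LinearMap.toSpanSingleton R X x)).liftQ _ le_rfl
  have : Mono (ModuleCat.ofHom φ) := (ModuleCat.mono_iff_injective _).2
    (LinearMap.ker_eq_bot.1 (Submodule.ker_liftQ_eq_bot' _ _ rfl))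
  exact T.prop_of_mono (ModuleCat.ofHom φ) hX

/-- An element killed by `a` generates a quotient of `R ⧸ a`, which is torsion. Conversely, elements
of the torsion part have annihilators in `torsionIdeals T`, so that part vanishes and `M` embeds in
`Y`. -/
theorem torsionFree_iff (hTF : IsHereditaryTorsionPair T F) (M : ModuleCat.{u} R) :
    F M ↔ IsClosed (torsionIdeals T) (⊥ : Submodule R M) := by
  have := hTF.torsion_quotients
  have := hTF.torsionFree_subobjects
  refine ⟨fun hM a ha z hz => ?_, fun h => ?_⟩
  · let φ := a.liftQ (LinearMap.toSpanSingleton R M z) hz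
    have hepi : Epi (ModuleCat.ofHom φ.rangeRestrict) :=
      (ModuleCat.epi_iff_surjective _).2 φ.surjective_rangeRestrict
    have hmono : Mono (ModuleCat.ofHom φ.range.subtype) :=
      (ModuleCat.mono_iff_injective _).2 φ.range.injective_subtype
    have hzero := hTF.isZero_of_mem (ModuleCat.of R φ.range)
      (T.prop_of_epi (ModuleCat.ofHom φ.rangeRestrict) ha)
      (F.prop_of_mono (ModuleCat.ofHom φ.range.subtype) hM)
    have := ModuleCat.subsingleton_of_isZero hzero
    have hmem : z ∈ φ.range := ⟨a.mkQ 1, one_smul R z⟩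
    exact congrArg Subtype.val (Subsingleton.elim (⟨z, hmem⟩ : φ.range) 0)
  · obtain ⟨X, Y, i, p, w, hs, hX, hY⟩ := hTF.exists_shortExact M
    have hinj : Function.Injective p := (injective_iff_map_eq_zero _).2 fun z hz => by
      obtain ⟨x, rfl⟩ := (ShortComplex.moduleCat_exact_iff _).1 hs.exact z hz
      refine h _ (hTF.annihilator_mem hX x) _ fun r hr => ?_
      have : r • x = 0 := by simpa using hr
      change r • i x = 0
      rw [← map_smul, this, map_zero]
    have := (ModuleCat.mono_iff_injective p).2 hinj
    exact F.prop_of_mono p hY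

/-- The closure of `N` is the preimage of the torsion part of `G ⧸ N`. -/
theorem hasClosures (hTF : IsHereditaryTorsionPair T F) : HasClosures (torsionIdeals T) := by
  intro G _ _ N
  obtain ⟨X, Y, i, p, w, hs, hX, hY⟩ := hTF.exists_shortExact (ModuleCat.of R (G ⧸ N))
  refine ⟨LinearMap.ker (p.hom ∘ₗ N.mkQ), fun z hz => ?_,
    ((hTF.torsionFree_iff Y).1 hY).comap (p.hom ∘ₗ N.mkQ), fun y hy => ?_⟩
  · have : N.mkQ z = 0 := (Submodule.Quotient.mk_eq_zero N).2 hz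
    simp [this]
  · obtain ⟨x, hx⟩ := (ShortComplex.moduleCat_exact_iff _).1 hs.exact (N.mkQ y) hy
    refine ⟨_, hTF.annihilator_mem hX x, fun r hr => ?_⟩
    have hrx : r • x = 0 := by simpa using hr
    have : r • N.mkQ y = 0 := by
      rw [← hx]
      change r • i x = 0
      rw [← map_smul, hrx, map_zero]
    rw [← map_smul] at this
    exact (Submodule.Quotient.mk_eq_zero N).1 this

end IsHereditaryTorsionPair

end torsionPair

theorem theorem4p8 {R : Type u} [Ring R] (T F : ObjectProperty (ModuleCat.{u} R))
    (hTF : IsHereditaryTorsionPair T F) (hfin : IsOfFiniteType T) :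
    IsCovering F := by
  intro M
  obtain ⟨P, _, _, f, hP, hlift, haut⟩ := LeftIdealFilter.exists_cover
    (𝒢 := torsionIdeals T) (fun a ha => (hfin a ha).imp fun b hb => ⟨hb.2.2, hb.1, hb.2.1⟩)
    hTF.hasClosures M
  refine ⟨ModuleCat.of R P, ModuleCat.ofHom f, ⟨(hTF.torsionFree_iff _).2 hP, fun H g hH => ?_⟩,
    fun e he => ?_⟩
  · obtain ⟨h, hh⟩ := hlift H g.hom ((hTF.torsionFree_iff H).1 hH)
    exact ⟨ModuleCat.ofHom h, ModuleCat.hom_ext hh⟩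
  · rw [ConcreteCategory.isIso_iff_bijective]
    exact haut e.hom (congrArg ModuleCat.Hom.hom he)
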